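/- **Theorem 3.15.** Let $\mathbb{F}_q$ be a finite field with $q=p^m$ elements ($p$ prime), let $\sigma$ be a ring endomorphism of $\mathbb{F}_q$ and let $\delta$ be a $\sigma$-derivation of $\mathbb{F}_q$, i.e. an additive map with $\delta(ab)=\sigma(a)\delta(b)+\delta(a)b$. Let $\mathbb{F}_q[x;\sigma,\delta]$ be the skew polynomial ring of polynomials $\sum_i a_ix^i$ with the product determined by $xa=\sigma(a)x+\delta(a)$. An element $\alpha$ is a *right root* of a skew polynomial $h$ if the remainder of $h$ upon right division by $x-\alpha$ is $0$, i.e. if $h=u\cdot(x-\alpha)$ for some skew polynomial $u$. A *polynomial ring extension* of $\mathbb{F}_q[x;\sigma,\delta]$ is a skew polynomial ring $\tilde{\mathbb{F}}[x;\tilde\sigma,\tilde\delta]$ over a division ring $\tilde{\mathbb{F}}$ that contains $\mathbb{F}_q$ as a subring, where $\tilde\sigma$ is a ring endomorphism of $\tilde{\mathbb F}$ and $\tilde\delta$ a $\tilde\sigma$-derivation of $\tilde{\mathbb F}$ with $\tilde\sigma|_{\mathbb{F}_q}=\sigma$ and $\tilde\delta|_{\mathbb{F}_q}=\delta$. Let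 $f,g\in\mathbb{F}_q[x;\sigma,\delta]$ be non-constant, of degrees $k$ and $n$. Their *right $(\sigma,\delta)$-resultant* $R^{\sigma,\delta}_{\mathbb{F}_q}(f,g)$ is the determinant of the $(k+n)\times(k+n)$ matrix whose rows are the coefficient vectors (with respect to $1,x,\dots,x^{k+n-1}$) of $f,xf,\dots,x^{n-1}f,g,xg,\dots,x^{k-1}g$; explicitly, the coefficient of $x^s$ in $x^r\sum_i a_ix^i$ is $\sum_{l=0}^{\min(r,s)}\mathcal{C}_{r-l,l}(a_{s-l})$, where $\mathcal{C}_{d,e}(a)$ is the sum of all compositions of $d$ copies of $\delta$ and $e$ copies of $\sigma$, evaluated at $a$, and $a_i=0$ for $i$ above the degree. Then: 1. $f$ and $g$ have a common right root in some polynomial ring extension $\tilde{\mathbb{F}}[x;\tilde\sigma,\tilde\delta]$ of $\mathbb{F}_q[x;\sigma,\delta]$ (that is, a common right root $\alpha\in\tilde{\mathbb{F}}$) if and only if $R^{\sigma,\delta}_{\mathbb{F}_q}(f,g)=0$. 2. If $R^{\sigma,\delta}_{\mathbb{F}_q}(f,g)=0$, the extension can be taken to be a field extension with $\sigma$ and $\delta$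 extended trivially: there are an integer $j$ with $1\le j\le m$ and an element $\beta\in\mathbb{F}_q$ with $\sigma(a)=a^{p^j}$ and $\delta(a)=\beta(\sigma(a)-a)$ for all $a\in\mathbb{F}_q$, and a field extension $\tilde{\mathbb{F}}/\mathbb{F}_q$ such that $f$ and $g$ have a common right root in the polynomial ring extension $\tilde{\mathbb{F}}[x;\tilde\sigma,\tilde\delta]$ with $\tilde\sigma(b)=b^{p^j}$ and $\tilde\delta(b)=\beta(\tilde\sigma(b)-b)$ for all $b\in\tilde{\mathbb{F}}$. -/

import Mathlib

open Polynomial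

universe u v

/-- A `σ`-derivation of a ring `F`: an additive map `δ` with `δ (a b) = σ a · δ b + δ a · b`. -/
structure SkewDerivation {F : Type*} [Ring F] (σ : F →+* F) extends F →+ F where
  leibniz' : ∀ a b : F, toFun (a * b) = σ a * toFun b + toFun a * b

namespace SkewDerivation

instance {F : Type*} [Ring F] {σ : F →+* F} : CoeFun (SkewDerivation σ) (fun _ => F → F) :=
  ⟨fun δ => δ.toAddMonoidHom⟩

theorem leibniz {F : Type*} [Ring F] {σ : F →+* F} (δ : SkewDerivation σ) (a b : F) :
    δ (a * b) = σ a * δ b + δ a * b := δ.leibniz' a b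

theorem map_one {F : Type*} [Ring F] {σ : F →+* F} (δ : SkewDerivation σ) : δ 1 = 0 := by
  have h := δ.leibniz 1 1
  simpa using h

/-- `δ.comps d s a` is the sum of all compositions of `d` copies of `δ` and `s` copies of `σ`,
evaluated at `a`; the compositions are sorted by their outermost factor. -/
def comps {F : Type*} [Ring F] {σ : F →+* F} (δ : SkewDerivation σ) : ℕ → ℕ → F → F
  | 0, 0, a => a
  | d + 1, 0, a => δ (comps δ d 0 a)
  | 0, s + 1, a => σ (comps δ 0 s a)
  | d + 1, s + 1, a => δ (comps δ d (s + 1) a) + σ (comps δ (d + 1) s a)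

end SkewDerivation

/-- The underlying set of the skew polynomial ring (Ore extension) `F[x; σ, δ]`: all polynomials
`∑ aᵢ xⁱ` with coefficients on the left. Only the additive structure is inherited from the ordinary
polynomials; the product is defined below. -/
def OrePolynomial {F : Type*} [Ring F] (σ : F →+* F) (_δ : SkewDerivation σ) : Type _ := F[X]

namespace OrePolynomial

section

variable {F : Type*} [Ring F] {σ : F →+* F} {δ : SkewDerivation σ}

noncomputable instance : AddCommGroup (OrePolynomial σ δ) := inferInstanceAs (AddCommGroup F[X])

variable (σ δ) in
/-- The skew polynomial with the same (left) coefficients as a given ordinary polynomial. -/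
noncomputable def ofPoly : F[X] ≃+ OrePolynomial σ δ := AddEquiv.refl F[X]

/-- The ordinary polynomial with the same coefficients as a given skew polynomial. -/
noncomputable def toPoly (f : OrePolynomial σ δ) : F[X] := (ofPoly σ δ).symm f

/-- The coefficient `aᵢ` of `f = ∑ aᵢ xⁱ`. -/
noncomputable def coeff (f : OrePolynomial σ δ) (i : ℕ) : F := f.toPoly.coeff i

/-- The degree of `f`, with the value `0` at `f = 0`. -/
noncomputable def natDegree (f : OrePolynomial σ δ) : ℕ := f.toPoly.natDegree

/-- Constants. -/
noncomputable def const (a : F) : OrePolynomial σ δ := ofPoly σ δ (Polynomial.C a)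

variable (σ δ) in
/-- The variable `x`. -/
noncomputable def var : OrePolynomial σ δ := ofPoly σ δ Polynomial.X

variable (δ) in
/-- Left multiplication by `x`, forced by `x b = σ(b) x + δ(b)`:
`x · ∑ bⱼ xʲ = ∑ (σ(bⱼ) xʲ⁺¹ + δ(bⱼ) xʲ)`. -/
noncomputable def varMul : F[X] →+ F[X] where
  toFun g := g.sum fun j b => monomial (j + 1) (σ b) + monomial j (δ b)
  map_zero' := by simp
  map_add' g h := by
    refine Polynomial.sum_add_index g h _ (fun i => by simp) (fun i a b => ?_)
    simp only [map_add]
    abel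

variable (δ) in
theorem varMul_monomial (j : ℕ) (b : F) :
    varMul δ (monomial j b) = monomial (j + 1) (σ b) + monomial j (δ b) := by
  exact Polynomial.sum_monomial_index b
    (fun j b => monomial (j + 1) (σ b) + monomial j (δ b)) (by simp)

variable (δ) in
/-- The product of skew polynomials, `(∑ aᵢ xⁱ) · g = ∑ aᵢ (xⁱ · g)`. -/
noncomputable def mulHom : F[X] →+ F[X] →+ F[X] where
  toFun f :=
    { toFun := fun g => f.sum fun i a => Polynomial.C a * (varMul δ)^[i] g
      map_zero' := by simp [Polynomial.sum_def]
      map_add' := fun g h => by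
        simp only [Polynomial.sum_def, iterate_map_add, mul_add, Finset.sum_add_distrib] }
  map_zero' := by ext; simp
  map_add' f f' := by
    refine AddMonoidHom.ext fun g => ?_
    exact Polynomial.sum_add_index f f' (fun i a => Polynomial.C a * (varMul δ)^[i] g)
      (fun i => by simp) (fun i a b => by simp only [map_add, add_mul])

noncomputable instance : Mul (OrePolynomial σ δ) :=
  ⟨fun f g => ofPoly σ δ (mulHom δ f.toPoly g.toPoly)⟩

noncomputable instance : One (OrePolynomial σ δ) := ⟨const 1⟩

variable (δ) in
theorem mulHom_monomial (i : ℕ) (a : F) (g : F[X]) :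
    mulHom δ (monomial i a) g = Polynomial.C a * (varMul δ)^[i] g := by
  exact Polynomial.sum_monomial_index a
    (fun i a => Polynomial.C a * (varMul δ)^[i] g) (by simp)

variable (δ) in
theorem varMul_C_mul (b : F) (g : F[X]) :
    varMul δ (Polynomial.C b * g) =
      Polynomial.C (σ b) * varMul δ g + Polynomial.C (δ b) * g := by
  induction g using Polynomial.induction_on' with
  | add p q hp hq =>
    simp only [mul_add, map_add, hp, hq]
    abel
  | monomial j c =>
    simp only [Polynomial.C_mul_monomial, varMul_monomial, mul_add, map_mul, δ.leibniz, map_add]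
    abel

variable (δ) in
theorem mulHom_C_mul (b : F) (f g : F[X]) :
    mulHom δ (Polynomial.C b * f) g = Polynomial.C b * mulHom δ f g := by
  induction f using Polynomial.induction_on' with
  | add p q hp hq => simp only [mul_add, map_add, AddMonoidHom.add_apply, hp, hq]
  | monomial j c =>
    simp only [Polynomial.C_mul_monomial, mulHom_monomial, map_mul, mul_assoc]

variable (δ) in
theorem mulHom_varMul (f g : F[X]) :
    mulHom δ (varMul δ f) g = varMul δ (mulHom δ f g) := by
  induction f using Polynomial.induction_on' with
  | add p q hp hq => simp only [map_add, AddMonoidHom.add_apply, hp, hq]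
  | monomial j c =>
    simp only [varMul_monomial, map_add, AddMonoidHom.add_apply, mulHom_monomial, varMul_C_mul,
      Function.iterate_succ_apply']

variable (δ) in
theorem mulHom_assoc (f g h : F[X]) :
    mulHom δ (mulHom δ f g) h = mulHom δ f (mulHom δ g h) := by
  have key : ∀ i : ℕ, mulHom δ ((varMul δ)^[i] g) h = (varMul δ)^[i] (mulHom δ g h) := by
    intro i
    induction i with
    | zero => rfl
    | succ i ih => rw [Function.iterate_succ_apply', Function.iterate_succ_apply', mulHom_varMul, ih]
  induction f using Polynomial.induction_on' with
  | add p q hp hq => simp only [map_add, AddMonoidHom.add_apply, hp, hq]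
  | monomial j c => simp only [mulHom_monomial, mulHom_C_mul, key]

variable (δ) in
theorem iterate_varMul_one (i : ℕ) : (varMul δ)^[i] (Polynomial.C 1) = monomial i 1 := by
  induction i with
  | zero => rfl
  | succ i ih => rw [Function.iterate_succ_apply', ih, varMul_monomial]; simp [δ.map_one]

variable (δ) in
theorem mulHom_one (f : F[X]) : mulHom δ f (Polynomial.C 1) = f := by
  induction f using Polynomial.induction_on' with
  | add p q hp hq => simp only [map_add, AddMonoidHom.add_apply, hp, hq]
  | monomial j c =>
    rw [mulHom_monomial, iterate_varMul_one, Polynomial.C_mul_monomial, mul_one]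

variable (δ) in
theorem one_mulHom (f : F[X]) : mulHom δ (Polynomial.C 1) f = f := by
  change mulHom δ (monomial 0 1) f = f
  rw [mulHom_monomial]
  simp

/-- The skew polynomial ring `F[x; σ, δ]`. -/
noncomputable instance : Ring (OrePolynomial σ δ) :=
  { (inferInstance : AddCommGroup (OrePolynomial σ δ)),
    (inferInstance : Mul (OrePolynomial σ δ)),
    (inferInstance : One (OrePolynomial σ δ)) with
    left_distrib := fun f g h => map_add (mulHom δ f) g h
    right_distrib := fun f g h => DFunLike.congr_fun (map_add (mulHom δ) f g) h
    zero_mul := fun f => DFunLike.congr_fun (map_zero (mulHom δ)) f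
    mul_zero := fun f => map_zero (mulHom δ f)
    mul_assoc := fun f g h => mulHom_assoc δ f g h
    one_mul := fun f => one_mulHom δ f
    mul_one := fun f => mulHom_one δ f }

/-- The defining relation `x a = σ(a) x + δ(a)`. -/
theorem var_mul_const (a : F) :
    var σ δ * const a = const (σ a) * var σ δ + const (δ a) := by
  have h : mulHom δ (monomial 1 1) (monomial 0 a) =
      mulHom δ (monomial 0 (σ a)) (monomial 1 1) + monomial 0 (δ a) := by
    rw [mulHom_monomial, mulHom_monomial, Function.iterate_one, varMul_monomial]
    simp [Polynomial.C_mul_monomial]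
  exact h

/-- `r` is the remainder of `f` upon right division by `x - a`: `f = q · (x - a) + r` for some `q`.
So `r` is the right evaluation of `f` at `a`. -/
def IsRightRemainder (f : OrePolynomial σ δ) (a r : F) : Prop :=
  ∃ q : OrePolynomial σ δ, f = q * (var σ δ - const a) + const r

/-- `a` is a right root of `f`: the right evaluation of `f` at `a` is zero. -/
def IsRightRoot (f : OrePolynomial σ δ) (a : F) : Prop := IsRightRemainder f a 0

/-- The coefficient of `x^q` in `x^p · f`, written through the coefficients of `f`. -/
noncomputable def sylvesterEntry (f : OrePolynomial σ δ) (p q : ℕ) : F :=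
  ∑ l ∈ Finset.range (p + 1), if l ≤ q then δ.comps (p - l) l (f.coeff (q - l)) else 0

/-- The right `(σ, δ)`-Sylvester matrix of `f` and `g`, of respective degrees `m` and `n`: the first
`n` rows come from `f` and the last `m` rows from `g`. -/
noncomputable def sylvester (f g : OrePolynomial σ δ) :
    Matrix (Fin (f.natDegree + g.natDegree)) (Fin (f.natDegree + g.natDegree)) F :=
  Matrix.of fun r c =>
    if (r : ℕ) < g.natDegree then f.sylvesterEntry r c
    else g.sylvesterEntry (r - g.natDegree) c

end

/-- The right `(σ, δ)`-resultant over a (commutative) field, where the Dieudonné determinant is the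
determinant. -/
noncomputable def resultant {F : Type*} [Field F] {σ : F →+* F} {δ : SkewDerivation σ}
    (f g : OrePolynomial σ δ) : F :=
  (sylvester f g).det

/-- `K[x; σ', δ']` is a polynomial ring extension of `F[x; σ, δ]` along the embedding `ι : F → K`:
the maps `σ'` and `δ'` restrict to `σ` and `δ` on `F`. -/
structure IsExtension {F K : Type*} [DivisionRing F] [DivisionRing K] (ι : F →+* K)
    {σ : F →+* F} (δ : SkewDerivation σ) {σ' : K →+* K} (δ' : SkewDerivation σ') : Prop where
  map_endo : ∀ a : F, σ' (ι a) = ι (σ a)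
  map_deriv : ∀ a : F, δ' (ι a) = ι (δ a)

/-- The skew polynomial `f` read in `K[x; σ', δ']`, coefficient by coefficient. -/
noncomputable def baseChange {F K : Type*} [DivisionRing F] [DivisionRing K] (ι : F →+* K)
    {σ : F →+* F} {δ : SkewDerivation σ} {σ' : K →+* K} (δ' : SkewDerivation σ')
    (f : OrePolynomial σ δ) : OrePolynomial σ' δ' :=
  ofPoly σ' δ' (f.toPoly.map ι)

end OrePolynomial

/-! For a point `α`, the quotient of the skew polynomial ring by the left ideal generated by `x - α`
is a copy of the coefficient ring, on which `x` acts by `T b = σ b * α + δ b`. Hence the remainder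
of `f` at `α` is `f(T) 1` (`isRightRoot_iff`), and `f ↦ f(T)` turns products into compositions
(`opEval_mulHom`).

A common root makes the vector of the `T^c 1` a right kernel vector of the Sylvester matrix with
first entry `1`, so the resultant vanishes (`resultant_eq_zero_of_opEval`). This uses an inverse
over the commutative `F` only, so the extension may be any division ring.

Conversely, a left kernel vector is a relation `a f + b g = 0` with `a ≠ 0` and `deg a < deg g`; a
dimension count then excludes a constant greatest common right divisor
(`exists_common_right_divisor`). Over a finite field `σ` is a power of Frobenius and `δ` is inner,
so both extend by the same formulas to an algebraically closed field. There `d(T) 1`, for the common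
divisor `d`, is a nonconstant ordinary polynomial in `α` (`exists_opEval_eq_zero`), and its zero is
a common root. -/

namespace OrePolynomial

/-! ### Right evaluation through the operator action of `x` -/

section Evaluation

variable {F K : Type*} [Ring F] [Ring K]

/-- Evaluation of `∑ aᵢ xⁱ` on `b`, where `x` acts by the additive map `T` and scalars act by left
multiplication through `ι`. -/
noncomputable def opEval (ι : F →+* K) (T : K →+ K) (b : K) : F[X] →+ K where
  toFun h := h.sum fun s a => ι a * T^[s] b
  map_zero' := by simp
  map_add' f g := Polynomial.sum_add_index f g _ (by simp) (by simp [add_mul])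

theorem opEval_apply (ι : F →+* K) (T : K →+ K) (b : K) (h : F[X]) :
    opEval ι T b h = h.sum fun s a => ι a * T^[s] b := rfl

theorem opEval_monomial (ι : F →+* K) (T : K →+ K) (b : K) (s : ℕ) (a : F) :
    opEval ι T b (monomial s a) = ι a * T^[s] b :=
  Polynomial.sum_monomial_index a (fun s a => ι a * T^[s] b) (by simp)

theorem opEval_C_mul (ι : F →+* K) (T : K →+ K) (b : K) (a : F) (h : F[X]) :
    opEval ι T b (Polynomial.C a * h) = ι a * opEval ι T b h := by
  induction h using Polynomial.induction_on' with
  | add p q hp hq => simp only [mul_add, map_add, hp, hq]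
  | monomial j c => simp only [Polynomial.C_mul_monomial, opEval_monomial, map_mul, mul_assoc]

theorem opEval_map (ι : F →+* K) (T : K →+ K) (b : K) (h : F[X]) :
    opEval (RingHom.id K) T b (h.map ι) = opEval ι T b h := by
  induction h using Polynomial.induction_on' with
  | add p q hp hq => simp only [Polynomial.map_add, map_add, hp, hq]
  | monomial j c => simp only [Polynomial.map_monomial, opEval_monomial, RingHom.id_apply]

variable {σ : F →+* F} {δ : SkewDerivation σ}

theorem opEval_varMul {ι : F →+* K} {T : K →+ K}
    (hT : ∀ a b, T (ι a * b) = ι (σ a) * T b + ι (δ a) * b) (b : K) (h : F[X]) :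
    opEval ι T b (varMul δ h) = T (opEval ι T b h) := by
  induction h using Polynomial.induction_on' with
  | add p q hp hq => simp only [map_add, hp, hq]
  | monomial j c =>
    simp only [varMul_monomial, map_add, opEval_monomial, hT, Function.iterate_succ_apply']

theorem opEval_iterate_varMul {ι : F →+* K} {T : K →+ K}
    (hT : ∀ a b, T (ι a * b) = ι (σ a) * T b + ι (δ a) * b) (b : K) (i : ℕ) (h : F[X]) :
    opEval ι T b ((varMul δ)^[i] h) = T^[i] (opEval ι T b h) := by
  induction i with
  | zero => rfl
  | succ i ih => rw [Function.iterate_succ_apply', Function.iterate_succ_apply',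
      opEval_varMul hT, ih]

/-- `hT` is the relation `x a = σ(a) x + δ(a)` for operators, so `x ↦ T` respects products: `g` acts
first, then `f`. -/
theorem opEval_mulHom {ι : F →+* K} {T : K →+ K}
    (hT : ∀ a b, T (ι a * b) = ι (σ a) * T b + ι (δ a) * b) (b : K) (f g : F[X]) :
    opEval ι T b (mulHom δ f g) = opEval ι T (opEval ι T b g) f := by
  induction f using Polynomial.induction_on' with
  | add p q hp hq => simp only [map_add, AddMonoidHom.add_apply, hp, hq]
  | monomial j c =>
    rw [mulHom_monomial, opEval_C_mul, opEval_monomial, opEval_iterate_varMul hT]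

/-- The action of `x` on `F ≅ F[x; σ, δ] / F[x; σ, δ] (x - α)`. -/
def varAct (δ : SkewDerivation σ) (α : F) : F →+ F where
  toFun b := σ b * α + δ b
  map_zero' := by simp
  map_add' a b := by simp only [map_add, add_mul]; abel

theorem varAct_apply (α b : F) : varAct δ α b = σ b * α + δ b := rfl

theorem varAct_mul (α a b : F) :
    varAct δ α (a * b) = σ a * varAct δ α b + δ a * b := by
  simp only [varAct_apply, map_mul, δ.leibniz, mul_add, mul_assoc, add_assoc]

theorem const_mul_const (a b : F) :
    (const a * const b : OrePolynomial σ δ) = const (a * b) := by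
  change mulHom δ (monomial 0 a) (Polynomial.C b) = Polynomial.C (a * b)
  rw [mulHom_monomial]
  simp

theorem const_add (a b : F) :
    (const (a + b) : OrePolynomial σ δ) = const a + const b :=
  Polynomial.C_add

theorem const_zero : (const 0 : OrePolynomial σ δ) = 0 := Polynomial.C_0

/-- If `c` is the remainder of `x ^ s`, then `x c = σ(c) (x - α) + (σ(c) α + δ(c))`, so the next
remainder is `T c`. -/
theorem exists_var_pow_eq (α : F) (s : ℕ) :
    ∃ q : OrePolynomial σ δ,
      var σ δ ^ s = q * (var σ δ - const α) + const ((varAct δ α)^[s] 1) := by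
  induction s with
  | zero => exact ⟨0, by simp; rfl⟩
  | succ s ih =>
    obtain ⟨q, hq⟩ := ih
    refine ⟨var σ δ * q + const (σ ((varAct δ α)^[s] 1)), ?_⟩
    rw [Function.iterate_succ_apply', varAct_apply, pow_succ', hq, const_add, ← const_mul_const,
      mul_add, var_mul_const]
    noncomm_ring

theorem var_mul_eq (f : OrePolynomial σ δ) : var σ δ * f = varMul δ f.toPoly := by
  change mulHom δ (monomial 1 1) f.toPoly = varMul δ f.toPoly
  rw [mulHom_monomial]
  simp

theorem var_pow_eq (s : ℕ) : var σ δ ^ s = ofPoly σ δ (monomial s 1) := by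
  induction s with
  | zero => rfl
  | succ s ih =>
    rw [pow_succ', ih, var_mul_eq]
    refine (varMul_monomial δ s 1).trans ?_
    rw [map_one, δ.map_one, map_zero, add_zero]
    rfl

theorem ofPoly_monomial (s : ℕ) (a : F) :
    ofPoly σ δ (monomial s a) = const a * var σ δ ^ s := by
  rw [var_pow_eq]
  change monomial s a = mulHom δ (monomial 0 a) (monomial s 1)
  rw [mulHom_monomial]
  simp [Polynomial.C_mul_monomial]

theorem isRightRemainder_opEval (α : F) (h : F[X]) :
    IsRightRemainder (ofPoly σ δ h) α (opEval (RingHom.id F) (varAct δ α) 1 h) := by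
  induction h using Polynomial.induction_on' with
  | add p q hp hq =>
    obtain ⟨u, hu⟩ := hp
    obtain ⟨v, hv⟩ := hq
    refine ⟨u + v, ?_⟩
    rw [map_add, map_add, const_add, hu, hv, add_mul, add_add_add_comm]
  | monomial s a =>
    obtain ⟨q, hq⟩ := exists_var_pow_eq (δ := δ) α s
    refine ⟨const a * q, ?_⟩
    rw [ofPoly_monomial, hq, opEval_monomial, RingHom.id_apply, ← const_mul_const,
      mul_add, mul_assoc]

theorem isRightRoot_iff (f : OrePolynomial σ δ) (α : F) :
    f.IsRightRoot α ↔ opEval (RingHom.id F) (varAct δ α) 1 f.toPoly = 0 := by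
  constructor
  · rintro ⟨q, hq⟩
    rw [const_zero, add_zero] at hq
    have hX : (var σ δ - const α : OrePolynomial σ δ) =
        ofPoly σ δ (Polynomial.X - Polynomial.C α) := (map_sub (ofPoly σ δ) _ _).symm
    have hmul : f.toPoly = mulHom δ q.toPoly (Polynomial.X - Polynomial.C α) := by
      rw [hq, hX]
      rfl
    -- Since `T 1 = α`, the factor `x - α` sends `1` to `0`, and `q(T) 0 = 0`.
    rw [hmul, opEval_mulHom (fun a b => varAct_mul α a b), map_sub, ← Polynomial.monomial_one_one_eq_X,
      ← Polynomial.monomial_zero_left, opEval_monomial, opEval_monomial]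
    simp [varAct_apply, δ.map_one, opEval_apply, Polynomial.sum_def]
  · intro h
    have := isRightRemainder_opEval (δ := δ) α f.toPoly
    rwa [h] at this

end Evaluation

theorem isRightRoot_baseChange_iff {F K : Type*} [DivisionRing F] [DivisionRing K] (ι : F →+* K)
    {σ : F →+* F} {δ : SkewDerivation σ} {σ' : K →+* K} (δ' : SkewDerivation σ')
    (f : OrePolynomial σ δ) (α : K) :
    (f.baseChange ι δ').IsRightRoot α ↔ opEval ι (varAct δ' α) 1 f.toPoly = 0 := by
  rw [isRightRoot_iff, ← opEval_map ι]
  rfl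

theorem IsExtension.varAct_mul {F K : Type*} [DivisionRing F] [DivisionRing K] {ι : F →+* K}
    {σ : F →+* F} {δ : SkewDerivation σ} {σ' : K →+* K} {δ' : SkewDerivation σ'}
    (h : IsExtension ι δ δ') (α : K) (a : F) (b : K) :
    varAct δ' α (ι a * b) = ι (σ a) * varAct δ' α b + ι (δ a) * b := by
  rw [OrePolynomial.varAct_mul, h.map_endo, h.map_deriv]

/-! ### Degrees, right division and common right divisors -/

section Degree

variable {F : Type*} [Field F] {σ : F →+* F} (δ : SkewDerivation σ)

theorem coeff_varMul_zero (g : F[X]) : (varMul δ g).coeff 0 = δ (g.coeff 0) := by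
  induction g using Polynomial.induction_on' with
  | add p q hp hq => simp only [map_add, Polynomial.coeff_add, hp, hq]
  | monomial j c =>
    rw [varMul_monomial, Polynomial.coeff_add, Polynomial.coeff_monomial,
      Polynomial.coeff_monomial, Polynomial.coeff_monomial, if_neg (Nat.succ_ne_zero j), zero_add]
    split_ifs <;> simp

theorem coeff_varMul_succ (g : F[X]) (s : ℕ) :
    (varMul δ g).coeff (s + 1) = σ (g.coeff s) + δ (g.coeff (s + 1)) := by
  induction g using Polynomial.induction_on' with
  | add p q hp hq =>
    simp only [map_add, Polynomial.coeff_add, hp, hq]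
    abel
  | monomial j c =>
    simp only [varMul_monomial, Polynomial.coeff_add, Polynomial.coeff_monomial,
      Nat.add_right_cancel_iff]
    split_ifs <;> simp

/-- A ring endomorphism of a field is injective, so `σ` cannot kill the leading coefficient. -/
theorem degree_varMul (g : F[X]) : (varMul δ g).degree = g.degree + 1 := by
  rcases eq_or_ne g 0 with rfl | hg
  · simp
  rw [Polynomial.degree_eq_natDegree hg]
  refine Polynomial.degree_eq_of_le_of_coeff_ne_zero ?_ (n := g.natDegree + 1) ?_
  · refine Polynomial.degree_le_iff_coeff_zero _ _ |>.2 fun s hs => ?_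
    cases s with
    | zero => exact absurd hs (by simp)
    | succ s =>
      have hs : g.natDegree < s := by
        have := WithBot.coe_lt_coe.1 hs
        simpa using this
      rw [coeff_varMul_succ, Polynomial.coeff_eq_zero_of_natDegree_lt hs,
        Polynomial.coeff_eq_zero_of_natDegree_lt (hs.trans (Nat.lt_succ_self s))]
      simp
  · rw [coeff_varMul_succ, Polynomial.coeff_eq_zero_of_natDegree_lt (Nat.lt_succ_self _)]
    simpa using hg

theorem degree_iterate_varMul (i : ℕ) (g : F[X]) :
    ((varMul δ)^[i] g).degree = g.degree + i := by
  induction i with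
  | zero => simp
  | succ i ih =>
    rw [Function.iterate_succ_apply', degree_varMul, ih, Nat.cast_succ, add_assoc]

theorem degree_mulHom_monomial (i : ℕ) {a : F} (ha : a ≠ 0) (g : F[X]) :
    (mulHom δ (monomial i a) g).degree = i + g.degree := by
  rw [mulHom_monomial, Polynomial.degree_C_mul ha, degree_iterate_varMul, add_comm]

theorem degree_mulHom (f g : F[X]) : (mulHom δ f g).degree = f.degree + g.degree := by
  rcases eq_or_ne g 0 with rfl | hg
  · simp
  induction hn : f.support.card using Nat.strong_induction_on generalizing f with
  | _ n ih =>
    rcases eq_or_ne f 0 with rfl | hf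
    · simp
    have he := ih _ (hn ▸ Polynomial.eraseLead_support_card_lt hf) f.eraseLead rfl
    have hm := degree_mulHom_monomial δ f.natDegree (Polynomial.leadingCoeff_ne_zero.2 hf) g
    rw [← Polynomial.degree_eq_natDegree hf] at hm
    conv_lhs => rw [← Polynomial.eraseLead_add_monomial_natDegree_leadingCoeff f]
    rw [map_add, AddMonoidHom.add_apply, Polynomial.degree_add_eq_right_of_degree_lt, hm]
    rw [he, hm]
    exact WithBot.add_lt_add_right (Polynomial.degree_ne_bot.2 hg)
      (Polynomial.degree_eraseLead_lt hf)

theorem exists_eq_mulHom_add (d : F[X]) (hd : d ≠ 0) (h : F[X]) :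
    ∃ q r, h = mulHom δ q d + r ∧ r.degree < d.degree := by
  induction hn : h.degree using WellFoundedLT.induction generalizing h with
  | _ n ih =>
    rcases lt_or_ge h.degree d.degree with hlt | hle
    · exact ⟨0, h, by simp, hlt⟩
    have hh : h ≠ 0 := by
      rintro rfl
      simp [hd] at hle
    obtain ⟨i, hi⟩ := Nat.exists_eq_add_of_le (Polynomial.natDegree_le_natDegree hle)
    -- `x ^ i d` has the degree of `h`; a left scalar multiple of it cancels the leading term.
    set e := (varMul δ)^[i] d with he
    have hde : e.degree = h.degree := by
      rw [he, degree_iterate_varMul, Polynomial.degree_eq_natDegree hd,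
        Polynomial.degree_eq_natDegree hh, hi, Nat.cast_add]
    have he0 : e ≠ 0 := by
      rintro h0
      rw [h0] at hde
      exact hh (Polynomial.degree_eq_bot.1 (by rw [← hde, Polynomial.degree_zero]))
    have hc : h.leadingCoeff / e.leadingCoeff ≠ 0 :=
      div_ne_zero (Polynomial.leadingCoeff_ne_zero.2 hh) (Polynomial.leadingCoeff_ne_zero.2 he0)
    set c := h.leadingCoeff / e.leadingCoeff with hcdef
    have hlt : (h - Polynomial.C c * e).degree < h.degree := by
      refine Polynomial.degree_sub_lt_left (by rw [Polynomial.degree_C_mul hc, hde]) hh ?_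
      rw [Polynomial.leadingCoeff_mul, Polynomial.leadingCoeff_C, hcdef,
        div_mul_cancel₀ _ (Polynomial.leadingCoeff_ne_zero.2 he0)]
    obtain ⟨q, r, hqr, hr⟩ := ih _ (hn ▸ hlt) _ rfl
    refine ⟨q + monomial i c, r, ?_, hr⟩
    rw [map_add, AddMonoidHom.add_apply, mulHom_monomial, ← he, add_right_comm, ← hqr,
      sub_add_cancel]

/-- A greatest common right divisor with its Bézout identity. -/
theorem exists_gcrd (f g : F[X]) (hf : f ≠ 0) :
    ∃ d a b u w : F[X], d ≠ 0 ∧ f = mulHom δ a d ∧ g = mulHom δ b d ∧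
      d = mulHom δ u f + mulHom δ w g := by
  -- An element of least degree in the left ideal generated by `f` and `g` divides all of it: a
  -- nonzero remainder would be smaller.
  let S : Set F[X] := {d | d ≠ 0 ∧ ∃ u w, d = mulHom δ u f + mulHom δ w g}
  have hfS : f = mulHom δ (Polynomial.C 1) f + mulHom δ 0 g := by
    rw [one_mulHom]
    simp
  have hgS : g = mulHom δ 0 f + mulHom δ (Polynomial.C 1) g := by
    rw [one_mulHom]
    simp
  have hne : S.Nonempty := ⟨f, hf, _, _, hfS⟩
  obtain ⟨d, ⟨hd, u, w, hduw⟩, hmin⟩ :=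
    WellFounded.has_min (InvImage.wf Polynomial.degree wellFounded_lt) S hne
  have key : ∀ h u' w', h = mulHom δ u' f + mulHom δ w' g → ∃ a, h = mulHom δ a d := by
    intro h u' w' hh
    obtain ⟨q, r, hqr, hr⟩ := exists_eq_mulHom_add δ d hd h
    refine ⟨q, ?_⟩
    by_contra hcon
    refine hmin r ⟨?_, u' - mulHom δ q u, w' - mulHom δ q w, ?_⟩ hr
    · rintro rfl
      exact hcon (by simpa using hqr)
    · have : r = h - mulHom δ q d := by rw [hqr]; abel
      rw [this, hh]
      conv_lhs => rw [hduw]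
      simp only [map_sub, map_add, AddMonoidHom.sub_apply, mulHom_assoc]
      abel
  obtain ⟨a, ha⟩ := key f _ _ hfS
  obtain ⟨b, hb⟩ := key g _ _ hgS
  exact ⟨d, a, b, u, w, hd, ha, hb, hduw⟩

/-- A left common multiple `a f = - b g` of low degree forces a nonconstant common right divisor. -/
theorem exists_common_right_divisor {f g a b : F[X]} (hf : f ≠ 0) (hg : g ≠ 0) (ha : a ≠ 0)
    (hdeg : a.natDegree < g.natDegree) (hab : mulHom δ a f + mulHom δ b g = 0) :
    ∃ d u w : F[X], 0 < d.natDegree ∧ f = mulHom δ u d ∧ g = mulHom δ w d := by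
  obtain ⟨d, u, w, s, t, hd, hu, hw, hst⟩ := exists_gcrd δ f g hf
  refine ⟨d, u, w, Nat.pos_of_ne_zero fun h0 => ?_, hu, hw⟩
  obtain ⟨c, hc⟩ := Polynomial.natDegree_eq_zero.1 h0
  have hc0 : c ≠ 0 := by
    rintro rfl
    exact hd (by simpa using hc.symm)
  have hall : ∀ h : F[X], ∃ s t, h = mulHom δ s f + mulHom δ t g := by
    intro h
    obtain ⟨q, r, hqr, hr⟩ := exists_eq_mulHom_add δ d hd h
    have hr0 : r = 0 := by
      rw [← hc, Polynomial.degree_C hc0] at hr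
      exact Polynomial.degree_eq_bot.1 (Nat.WithBot.lt_zero_iff.1 hr)
    refine ⟨mulHom δ q s, mulHom δ q t, ?_⟩
    rw [hqr, hr0, add_zero, hst, map_add, mulHom_assoc, mulHom_assoc]
  -- If `d` is constant, every `h` is some `s f + t g`. Reducing `s` modulo `a` and moving the
  -- multiple of `a f = - b g` into `t` makes `ψ` cover all degrees below `deg g + deg f`, although
  -- its domain has dimension only `deg a + deg f`.
  let ψ : (Polynomial.degreeLT F a.natDegree × Polynomial.degreeLT F f.natDegree) →ₗ[F] F[X] :=
    { toFun := fun x => mulHom δ x.1 f + mulHom δ x.2 g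
      map_add' := fun x y => by
        simp only [Prod.fst_add, Prod.snd_add, Submodule.coe_add, map_add, AddMonoidHom.add_apply]
        abel
      map_smul' := fun c x => by
        simp only [Prod.smul_fst, Prod.smul_snd, Submodule.coe_smul, Polynomial.smul_eq_C_mul,
          mulHom_C_mul, RingHom.id_apply, mul_add] }
  have hsub : Polynomial.degreeLT F (g.natDegree + f.natDegree) ≤ LinearMap.range ψ := by
    intro h hh
    rw [Polynomial.mem_degreeLT] at hh
    obtain ⟨s, t, hst⟩ := hall h
    obtain ⟨q, r, hqr, hr⟩ := exists_eq_mulHom_add δ a ha s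
    have hab' : mulHom δ a f = - mulHom δ b g := eq_neg_of_add_eq_zero_left hab
    have hh' : h = mulHom δ r f + mulHom δ (t - mulHom δ q b) g := by
      rw [hst, hqr]
      simp only [map_sub, map_add, AddMonoidHom.sub_apply, AddMonoidHom.add_apply, mulHom_assoc,
        hab', map_neg]
      abel
    have hr' : r.degree < a.natDegree := by rwa [← Polynomial.degree_eq_natDegree ha]
    have hrf : (mulHom δ r f).degree < ((g.natDegree + f.natDegree : ℕ) : WithBot ℕ) := by
      rw [degree_mulHom, Nat.cast_add, ← Polynomial.degree_eq_natDegree hf]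
      exact WithBot.add_lt_add_right (Polynomial.degree_ne_bot.2 hf)
        (hr'.trans (by exact_mod_cast hdeg))
    -- The bound is forced: the product with `g` equals `h - r f`, of degree below `deg g + deg f`.
    have ht : (t - mulHom δ q b).degree < f.natDegree := by
      have h1 : (mulHom δ (t - mulHom δ q b) g).degree <
          ((g.natDegree + f.natDegree : ℕ) : WithBot ℕ) := by
        rw [eq_sub_iff_add_eq'.2 hh'.symm]
        exact (Polynomial.degree_sub_le _ _).trans_lt (max_lt hh hrf)
      rw [degree_mulHom, add_comm g.natDegree, Nat.cast_add,
        ← Polynomial.degree_eq_natDegree hg] at h1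
      exact lt_of_add_lt_add_right h1
    exact ⟨(⟨r, Polynomial.mem_degreeLT.2 hr'⟩, ⟨_, Polynomial.mem_degreeLT.2 ht⟩), hh'.symm⟩
  have hfin : ∀ n, Module.finrank F (Polynomial.degreeLT F n) = n := fun n => by
    rw [(Polynomial.degreeLTEquiv F n).finrank_eq, Module.finrank_fin_fun]
  have : ∀ n, Module.Finite F (Polynomial.degreeLT F n) := fun n =>
    Module.Finite.equiv (Polynomial.degreeLTEquiv F n).symm
  have h1 := Submodule.finrank_mono hsub
  have h2 := LinearMap.finrank_range_le ψ
  rw [Module.finrank_prod, hfin, hfin] at h2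
  rw [hfin] at h1
  omega

end Degree

end OrePolynomial

/-! ### The Sylvester matrix and the resultant -/

namespace OrePolynomial

/-- Words of length `p + 1` in two letters are sorted by their outermost letter; `A'` and `B'`
extend the two halves by zero where that letter does not occur. -/
theorem sum_antidiagonal_succ_of_pascal {M : Type*} [AddCommMonoid M] (c A B : ℕ → ℕ → M)
    (h : ∀ d s, c (d + 1) (s + 1) = A d (s + 1) + B (d + 1) s)
    (h₁ : ∀ d, c (d + 1) 0 = A d 0) (h₂ : ∀ s, c 0 (s + 1) = B 0 s) (p : ℕ) :
    ∑ x ∈ Finset.HasAntidiagonal.antidiagonal (p + 1), c x.1 x.2 =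
      ∑ x ∈ Finset.HasAntidiagonal.antidiagonal p, A x.1 x.2 + ∑ x ∈ Finset.HasAntidiagonal.antidiagonal p, B x.1 x.2 := by
  let A' : ℕ × ℕ → M := fun x => match x with
    | (0, _) => 0
    | (d + 1, s) => A d s
  let B' : ℕ × ℕ → M := fun x => match x with
    | (_, 0) => 0
    | (d, s + 1) => B d s
  have hsum : ∑ x ∈ Finset.HasAntidiagonal.antidiagonal (p + 1), c x.1 x.2 =
      ∑ x ∈ Finset.HasAntidiagonal.antidiagonal (p + 1), (A' x + B' x) := by
    refine Finset.sum_congr rfl fun x hx => ?_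
    obtain ⟨d, s⟩ := x
    rw [Finset.HasAntidiagonal.mem_antidiagonal] at hx
    cases d <;> cases s
    · simp at hx
    · simp [A', B', h₂]
    · simp [A', B', h₁]
    · simp [A', B', h]
  rw [hsum, Finset.sum_add_distrib, Finset.Nat.sum_antidiagonal_succ,
    Finset.Nat.sum_antidiagonal_succ']
  simp [A', B']

section Sylvester

variable {F : Type*} [Field F] {σ : F →+* F} {δ : SkewDerivation σ}

/-- Each factor `x` either applies `δ` in place or applies `σ` and raises the degree by one, so the
number of `σ`s is the shift. -/
theorem coeff_iterate_varMul (g : F[X]) (p q : ℕ) :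
    ((varMul δ)^[p] g).coeff q = ∑ x ∈ Finset.HasAntidiagonal.antidiagonal p,
      if x.2 ≤ q then δ.comps x.1 x.2 (g.coeff (q - x.2)) else 0 := by
  induction p generalizing q with
  | zero => simp [SkewDerivation.comps]
  | succ p ih =>
    rw [Function.iterate_succ_apply', sum_antidiagonal_succ_of_pascal
      (fun d s => if s ≤ q then δ.comps d s (g.coeff (q - s)) else 0)
      (fun d s => if s ≤ q then δ (δ.comps d s (g.coeff (q - s))) else 0)
      (fun d s => if s + 1 ≤ q then σ (δ.comps d s (g.coeff (q - (s + 1)))) else 0)]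
    · cases q with
      | zero =>
        rw [coeff_varMul_zero, ih, map_sum]
        simp [apply_ite]
      | succ q =>
        rw [coeff_varMul_succ, ih, ih, map_sum, map_sum, add_comm]
        simp [apply_ite]
    · intro d s
      split_ifs <;> simp [SkewDerivation.comps]
    · intro d
      simp [SkewDerivation.comps]
    · intro s
      split_ifs <;> simp [SkewDerivation.comps]

theorem sylvesterEntry_eq_coeff (f : OrePolynomial σ δ) (p q : ℕ) :
    f.sylvesterEntry p q = ((varMul δ)^[p] f.toPoly).coeff q := by
  rw [coeff_iterate_varMul, ← Finset.Nat.sum_antidiagonal_swap]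
  exact (Finset.Nat.sum_antidiagonal_eq_sum_range_succ
    (fun l d => if l ≤ q then δ.comps d l (f.toPoly.coeff (q - l)) else 0) p).symm

/-- The skew polynomial whose coefficients form the `r`-th row of the Sylvester matrix. -/
noncomputable def sylvesterRow (f g : OrePolynomial σ δ) (r : ℕ) : F[X] :=
  if r < g.natDegree then (varMul δ)^[r] f.toPoly else (varMul δ)^[r - g.natDegree] g.toPoly

theorem sylvester_apply (f g : OrePolynomial σ δ) (r c : Fin (f.natDegree + g.natDegree)) :
    sylvester f g r c = (sylvesterRow f g r).coeff c := by
  simp only [sylvester, Matrix.of_apply, sylvesterRow, sylvesterEntry_eq_coeff]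
  split_ifs <;> rfl

theorem degree_iterate_varMul_lt (f : OrePolynomial σ δ) {i N : ℕ} (h : i + f.natDegree < N) :
    ((varMul δ)^[i] f.toPoly).degree < N := by
  rw [degree_iterate_varMul]
  calc f.toPoly.degree + i ≤ (f.natDegree : WithBot ℕ) + i :=
        add_le_add_left Polynomial.degree_le_natDegree _
    _ < N := by
        rw [← Nat.cast_add, add_comm]
        exact_mod_cast h

theorem degree_sylvesterRow_lt (f g : OrePolynomial σ δ) {r : ℕ}
    (hr : r < f.natDegree + g.natDegree) :
    (sylvesterRow f g r).degree < ((f.natDegree + g.natDegree : ℕ) : WithBot ℕ) := by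
  unfold sylvesterRow
  split_ifs with h <;> exact degree_iterate_varMul_lt _ (by omega)

theorem opEval_sylvesterRow {K : Type*} [Ring K] {ι : F →+* K} {T : K →+ K}
    (hT : ∀ a b, T (ι a * b) = ι (σ a) * T b + ι (δ a) * b) (b : K) {f g : OrePolynomial σ δ}
    (hf : opEval ι T b f.toPoly = 0) (hg : opEval ι T b g.toPoly = 0) (r : ℕ) :
    opEval ι T b (sylvesterRow f g r) = 0 := by
  unfold sylvesterRow
  split_ifs
  · rw [opEval_iterate_varMul hT, hf, iterate_map_zero]
  · rw [opEval_iterate_varMul hT, hg, iterate_map_zero]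

theorem resultant_eq_zero_of_opEval {K : Type*} [Ring K] [Nontrivial K] {ι : F →+* K} {T : K →+ K}
    (hT : ∀ a b, T (ι a * b) = ι (σ a) * T b + ι (δ a) * b) {f g : OrePolynomial σ δ}
    (hdeg : 0 < f.natDegree) (hf : opEval ι T 1 f.toPoly = 0)
    (hg : opEval ι T 1 g.toPoly = 0) : f.resultant g = 0 := by
  by_contra hdet
  have hinv : (sylvester f g)⁻¹ * sylvester f g = 1 :=
    Matrix.nonsing_inv_mul _ (isUnit_iff_ne_zero.2 hdet)
  have hrow : ∀ r, ∑ c, ι (sylvester f g r c) * T^[(c : ℕ)] 1 = 0 := by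
    intro r
    rw [← opEval_sylvesterRow hT 1 hf hg r, opEval_apply,
      ← Polynomial.sum_fin (fun s a => ι a * T^[s] 1) (by simp) (degree_sylvesterRow_lt f g r.2)]
    simp only [sylvester_apply]
  -- Row `0` of the inverse isolates `T^0 1 = 1`, which therefore equals `0`.
  let z : Fin (f.natDegree + g.natDegree) := ⟨0, by omega⟩
  have h1 : ∑ r, ι ((sylvester f g)⁻¹ z r) * ∑ c, ι (sylvester f g r c) * T^[(c : ℕ)] 1 =
      T^[(z : ℕ)] 1 := by
    simp only [Finset.mul_sum]
    rw [Finset.sum_comm]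
    simp only [← mul_assoc, ← map_mul, ← Finset.sum_mul, ← map_sum, ← Matrix.mul_apply, hinv]
    rw [Finset.sum_eq_single z]
    · simp
    · intro c _ hc
      simp [Matrix.one_apply_ne hc.symm]
    · simp
  simp [hrow, z] at h1

theorem exists_common_right_divisor_of_resultant_eq_zero {f g : OrePolynomial σ δ}
    (hf : 0 < f.natDegree) (hg : 0 < g.natDegree) (h : f.resultant g = 0) :
    ∃ d u w : F[X], 0 < d.natDegree ∧ f.toPoly = mulHom δ u d ∧ g.toPoly = mulHom δ w d := by
  obtain ⟨v, hv, hvM⟩ := Matrix.exists_vecMul_eq_zero_iff.2 h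
  have hf0 : f.toPoly ≠ 0 := Polynomial.ne_zero_of_natDegree_gt hf
  have hg0 : g.toPoly ≠ 0 := Polynomial.ne_zero_of_natDegree_gt hg
  -- The left kernel vector is cut into the cofactor of `f` and that of `g`.
  let a : F[X] := ∑ r : Fin (f.natDegree + g.natDegree),
    if (r : ℕ) < g.natDegree then monomial (r : ℕ) (v r) else 0
  let b : F[X] := ∑ r : Fin (f.natDegree + g.natDegree),
    if (r : ℕ) < g.natDegree then 0 else monomial ((r : ℕ) - g.natDegree) (v r)
  have hab : mulHom δ a f.toPoly + mulHom δ b g.toPoly = 0 := by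
    have hsum : mulHom δ a f.toPoly + mulHom δ b g.toPoly =
        ∑ r : Fin (f.natDegree + g.natDegree), Polynomial.C (v r) * sylvesterRow f g r := by
      simp only [a, b, map_sum, AddMonoidHom.finsetSum_apply, ← Finset.sum_add_distrib]
      refine Finset.sum_congr rfl fun r _ => ?_
      unfold sylvesterRow
      split_ifs <;> simp [mulHom_monomial]
    rw [hsum]
    ext c
    rw [Polynomial.finsetSum_coeff, Polynomial.coeff_zero]
    simp only [Polynomial.coeff_C_mul]
    rcases lt_or_ge c (f.natDegree + g.natDegree) with hc | hc
    · have := congrFun hvM ⟨c, hc⟩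
      simpa only [Matrix.vecMul, dotProduct, sylvester_apply, Pi.zero_apply] using this
    · refine Finset.sum_eq_zero fun r _ => ?_
      rw [Polynomial.coeff_eq_zero_of_degree_lt, mul_zero]
      exact (degree_sylvesterRow_lt f g r.2).trans_le (by exact_mod_cast hc)
  have hadeg : a.degree < g.natDegree := by
    rw [← Polynomial.mem_degreeLT]
    refine Submodule.sum_mem _ fun r _ => ?_
    rw [Polynomial.mem_degreeLT]
    split_ifs with hr
    · exact (Polynomial.degree_monomial_le _ _).trans_lt (by exact_mod_cast hr)
    · simp
  -- If `a = 0`, then `b g = 0`, so `b = 0` by additivity of degrees, and the kernel vector is zero.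
  have ha : a ≠ 0 := by
    intro ha
    have hb : b = 0 := by
      have hb := congrArg Polynomial.degree hab
      rw [ha, map_zero, AddMonoidHom.zero_apply, zero_add, degree_mulHom, Polynomial.degree_zero,
        WithBot.add_eq_bot, Polynomial.degree_eq_bot, Polynomial.degree_eq_bot] at hb
      exact hb.resolve_right hg0
    refine hv (funext fun r => ?_)
    by_cases hr : (r : ℕ) < g.natDegree
    · have hcoeff := congrArg (fun p => Polynomial.coeff p (r : ℕ)) ha
      simp only [a, Polynomial.finsetSum_coeff, Polynomial.coeff_zero] at hcoeff
      rw [Finset.sum_eq_single r] at hcoeff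
      · simpa [hr] using hcoeff
      · intro s _ hs
        have : (s : ℕ) ≠ r := fun h => hs (Fin.ext h)
        split_ifs
        · exact Polynomial.coeff_monomial_of_ne _ this.symm
        · simp
      · simp
    · have hcoeff := congrArg (fun p => Polynomial.coeff p ((r : ℕ) - g.natDegree)) hb
      simp only [b, Polynomial.finsetSum_coeff, Polynomial.coeff_zero] at hcoeff
      rw [Finset.sum_eq_single r] at hcoeff
      · simpa [hr] using hcoeff
      · intro s _ hs
        have : (s : ℕ) ≠ r := fun h => hs (Fin.ext h)
        split_ifs
        · simp
        · exact Polynomial.coeff_monomial_of_ne _ (by omega)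
      · simp
  refine exists_common_right_divisor δ hf0 hg0 ha ?_ hab
  exact (Polynomial.natDegree_lt_iff_degree_lt ha).2 hadeg

end Sylvester

/-! ### Roots over an algebraically closed field -/

/-- For `σ'` a power map and `δ'` inner on an algebraically closed field, right evaluation is a
nonconstant polynomial function of the point, so it has a zero. -/
theorem exists_opEval_eq_zero {F K : Type*} [Field F] [Field K] [IsAlgClosed K] (ι : F →+* K)
    {σ' : K →+* K} (δ' : SkewDerivation σ') (q : ℕ) (hq : 0 < q) (β : K)
    (hσ : ∀ b, σ' b = b ^ q) (hδ : ∀ b, δ' b = β * (σ' b - b)) (d : F[X]) (hd : 0 < d.natDegree) :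
    ∃ α : K, opEval ι (varAct δ' α) 1 d = 0 := by
  -- `P s` is `T^s 1` as a polynomial in `α`, by `T b = b ^ q * α + β * (b ^ q - b)`.
  obtain ⟨P, hP0, hP⟩ : ∃ P : ℕ → K[X], P 0 = 1 ∧
      ∀ s, P (s + 1) = P s ^ q * Polynomial.X + Polynomial.C β * (P s ^ q - P s) :=
    ⟨fun s => Nat.rec 1
      (fun _ p => p ^ q * Polynomial.X + Polynomial.C β * (p ^ q - p)) s, rfl, fun _ => rfl⟩
  have heval : ∀ α s, (varAct δ' α)^[s] 1 = (P s).eval α := by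
    intro α s
    induction s with
    | zero => simp [hP0]
    | succ s ih =>
      rw [Function.iterate_succ_apply', ih, hP, varAct_apply, hδ, hσ]
      simp
  have hC : ∀ (c : K) (p : K[X]), (Polynomial.C c * p).degree ≤ p.degree := fun c p => by
    rw [← Polynomial.smul_eq_C_mul]
    exact Polynomial.degree_smul_le c p
  -- The factor `X` alone makes the growth strict, so `q = 1` is covered.
  have hdeg : ∀ s, P s ≠ 0 ∧ (P s).degree < (P (s + 1)).degree := by
    intro s
    have step : ∀ s, P s ≠ 0 → (P s).degree < (P (s + 1)).degree := by
      intro s h0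
      have hq0 : P s ^ q ≠ 0 := pow_ne_zero _ h0
      have hle : (P s).degree ≤ (P s ^ q).degree := by
        rw [Polynomial.degree_eq_natDegree h0, Polynomial.degree_eq_natDegree hq0,
          Polynomial.natDegree_pow]
        exact_mod_cast Nat.le_mul_of_pos_left _ hq
      have hlt : (P s ^ q).degree < (P s ^ q * Polynomial.X).degree := by
        rw [Polynomial.degree_mul, Polynomial.degree_X, Polynomial.degree_eq_natDegree hq0]
        exact_mod_cast Nat.lt_succ_self _
      rw [hP, Polynomial.degree_add_eq_left_of_degree_lt]
      · exact hle.trans_lt hlt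
      · refine lt_of_le_of_lt ?_ hlt
        refine (hC _ _).trans ?_
        exact (Polynomial.degree_sub_le _ _).trans (max_le le_rfl hle)
    induction s with
    | zero =>
      have h0 : P 0 ≠ 0 := hP0 ▸ one_ne_zero
      exact ⟨h0, step 0 h0⟩
    | succ s ih =>
      have h0 : P (s + 1) ≠ 0 := by
        intro h
        have := ih.2
        rw [h, Polynomial.degree_zero] at this
        exact not_lt_bot this
      exact ⟨h0, step _ h0⟩
  have hmono : StrictMono fun s => (P s).degree := strictMono_nat_of_lt_succ fun s => (hdeg s).2
  have hlead : ι d.leadingCoeff ≠ 0 := by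
    rw [Ne, map_eq_zero, Polynomial.leadingCoeff_eq_zero]
    exact Polynomial.ne_zero_of_natDegree_gt hd
  -- The `P s` have distinct degrees, so the top term of `d` cannot cancel.
  let Q : K[X] := ∑ s ∈ Finset.range (d.natDegree + 1), Polynomial.C (ι (d.coeff s)) * P s
  have hQ : 0 < Q.degree := by
    have hpos : 0 < (P d.natDegree).degree := by
      have := hmono hd
      simpa [hP0] using this
    have htop : (Polynomial.C (ι (d.coeff d.natDegree)) * P d.natDegree).degree =
        (P d.natDegree).degree := Polynomial.degree_C_mul hlead
    have hlow : (∑ s ∈ Finset.range d.natDegree, Polynomial.C (ι (d.coeff s)) * P s).degree <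
        (P d.natDegree).degree := by
      rw [Polynomial.degree_eq_natDegree (hdeg _).1, ← Polynomial.mem_degreeLT]
      refine Submodule.sum_mem _ fun s hs => ?_
      rw [Polynomial.mem_degreeLT, ← Polynomial.degree_eq_natDegree (hdeg _).1]
      exact (hC _ _).trans_lt (hmono (Finset.mem_range.1 hs))
    simp only [Q]
    rw [Finset.sum_range_succ, Polynomial.degree_add_eq_right_of_degree_lt (by rwa [htop]), htop]
    exact hpos
  obtain ⟨α, hα⟩ := IsAlgClosed.exists_root Q hQ.ne'
  refine ⟨α, ?_⟩
  rw [opEval_apply, Polynomial.sum_over_range _ (by simp), ← hα.eq_zero]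
  simp only [Q, Polynomial.eval_finsetSum, Polynomial.eval_mul, Polynomial.eval_C, heval]

end OrePolynomial

/-! ### Skew derivations and endomorphisms of finite fields -/

namespace SkewDerivation

variable {F : Type*} [Field F]

/-- The inner `σ`-derivation `a ↦ β (σ a - a)`. -/
def inner (σ : F →+* F) (β : F) : SkewDerivation σ where
  toFun a := β * (σ a - a)
  map_zero' := by simp
  map_add' a b := by simp only [map_add]; ring
  leibniz' a b := by simp only [map_mul]; ring

theorem inner_apply (σ : F →+* F) (β a : F) : inner σ β a = β * (σ a - a) := rfl

theorem map_pow_succ_of_eq_id {σ : F →+* F} (hσ : ∀ a, σ a = a) (δ : SkewDerivation σ) (a : F)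
    (n : ℕ) : δ (a ^ (n + 1)) = (n + 1) * a ^ n * δ a := by
  induction n with
  | zero => simp
  | succ n ih =>
    rw [pow_succ, δ.leibniz, ih, hσ]
    push_cast
    ring

/-- Every skew derivation of a finite field is inner. -/
theorem exists_eq_inner [Finite F] {σ : F →+* F} (δ : SkewDerivation σ) :
    ∃ β : F, ∀ a, δ a = β * (σ a - a) := by
  by_cases h : ∀ a, σ a = a
  -- For `σ = id`, applying `δ` to `a = a ^ |F|` gives `δ a = |F| * a ^ (|F| - 1) * δ a = 0`.
  · refine ⟨0, fun a => ?_⟩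
    have := Fintype.ofFinite F
    obtain ⟨n, hn⟩ := Nat.exists_eq_succ_of_ne_zero (Fintype.card_ne_zero (α := F))
    have h1 := δ.map_pow_succ_of_eq_id h a n
    have h2 : ((n : F) + 1) = 0 := by
      have := FiniteField.cast_card_eq_zero F
      rw [hn] at this
      exact_mod_cast this
    have h3 : a ^ (n + 1) = a := by
      have := FiniteField.pow_card a
      rwa [hn] at this
    rw [h3, h2] at h1
    simpa using h1
  · push Not at h
    obtain ⟨c, hc⟩ := h
    -- Expanding `δ (a c) = δ (c a)` both ways gives `δ a * (σ c - c) = δ c * (σ a - a)`.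
    refine ⟨δ c / (σ c - c), fun a => ?_⟩
    have h1 := δ.leibniz a c
    rw [mul_comm, δ.leibniz] at h1
    have h2 : σ c - c ≠ 0 := sub_ne_zero.2 hc
    field_simp
    linear_combination h1

end SkewDerivation

theorem FiniteField.exists_eq_pow_of_ringHom {F : Type*} [Field F] [Finite F] {p m : ℕ}
    [Fact p.Prime] [CharP F p] (hcard : Nat.card F = p ^ m) (σ : F →+* F) :
    ∃ j, 1 ≤ j ∧ j ≤ m ∧ ∀ a, σ a = a ^ p ^ j := by
  have := Fintype.ofFinite F
  let _ : Algebra (ZMod p) F := ZMod.algebra F p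
  have hfin : Module.finrank (ZMod p) F = m := by
    have h := Module.card_eq_pow_finrank (K := ZMod p) (V := F)
    rw [← Nat.card_eq_fintype_card, hcard, ZMod.card] at h
    exact (Nat.pow_right_injective (Fact.out : p.Prime).two_le h).symm
  let φ : F →ₐ[ZMod p] F := { σ with
    commutes' := fun r => RingHom.congr_fun
      (RingHom.ext_zmod (σ.comp (algebraMap (ZMod p) F)) (algebraMap (ZMod p) F)) r }
  obtain ⟨i, hi⟩ := (FiniteField.bijective_frobeniusAlgHom_pow (ZMod p) F).2 φ
  have hσ : ∀ a, σ a = a ^ p ^ (i : ℕ) := by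
    intro a
    have h := DFunLike.congr_fun hi a
    simp only [AlgHom.coe_pow, FiniteField.coe_frobeniusAlgHom, pow_iterate, ZMod.card] at h
    exact h.symm
  have him : (i : ℕ) < m := hfin ▸ i.2
  rcases Nat.eq_zero_or_pos (i : ℕ) with h0 | h0
  -- Exponent `0` is traded for `m`, since `a ^ p ^ m = a`.
  · refine ⟨m, by omega, le_rfl, fun a => ?_⟩
    rw [hσ, h0, pow_zero, pow_one, ← hcard, Nat.card_eq_fintype_card, FiniteField.pow_card]
  · exact ⟨i, h0, him.le, hσ⟩

/-- The closure is taken over `ZMod p`, in the lowest universe, so that it lifts to any `v`; `F` is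
algebraic over `ZMod p` and embeds. -/
theorem FiniteField.exists_ringHom_isAlgClosed (F : Type u) [Field F] [Finite F] (p : ℕ)
    [Fact p.Prime] [CharP F p] :
    ∃ (K : Type v) (_ : Field K) (_ : IsAlgClosed K) (_ : CharP K p), Nonempty (F →+* K) := by
  let _ : Algebra (ZMod p) F := ZMod.algebra F p
  let L := AlgebraicClosure (ZMod p)
  have : CharP L p := charP_of_injective_algebraMap (algebraMap (ZMod p) L).injective p
  let e : ULift.{v} L ≃+* L := ULift.ringEquiv
  have hclosed : IsAlgClosed (ULift.{v} L) := by
    refine IsAlgClosed.of_exists_root _ fun q _ hq => ?_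
    obtain ⟨x, hx⟩ := IsAlgClosed.exists_root (q.map (e : ULift.{v} L →+* L))
      (by rw [Polynomial.degree_map]; exact (Polynomial.degree_pos_of_irreducible hq).ne')
    refine ⟨e.symm x, e.injective ?_⟩
    rw [map_zero, ← hx.eq_zero, Polynomial.eval_map, ← RingEquiv.coe_toRingHom e,
      ← Polynomial.eval₂_at_apply]
    simp
  refine ⟨ULift.{v} L, inferInstance, hclosed,
    charP_of_injective_ringHom (f := (e.symm : L →+* ULift.{v} L)) e.symm.injective p,
    ⟨(e.symm : L →+* ULift.{v} L).comp (IsAlgClosed.lift (R := ZMod p) (S := F) (M := L)).toRingHom⟩⟩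

/-! ### The main theorem -/

theorem theorem3p15 {F : Type u} [Field F] [Finite F] (p m : ℕ) (hp : p.Prime)
    (hcard : Nat.card F = p ^ m) (σ : F →+* F) (δ : SkewDerivation σ)
    (f g : OrePolynomial σ δ) (hf : 0 < f.natDegree) (hg : 0 < g.natDegree) :
    ((∃ (K : Type v) (_ : DivisionRing K) (ι : F →+* K) (σ' : K →+* K) (δ' : SkewDerivation σ'),
        OrePolynomial.IsExtension ι δ δ' ∧
        ∃ α : K, (f.baseChange ι δ').IsRightRoot α ∧ (g.baseChange ι δ').IsRightRoot α) ↔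
      f.resultant g = 0) ∧
    (f.resultant g = 0 →
      ∃ (j : ℕ) (β : F), 1 ≤ j ∧ j ≤ m ∧ (∀ a : F, σ a = a ^ p ^ j) ∧
        (∀ a : F, δ a = β * (σ a - a)) ∧
        ∃ (K : Type v) (_ : Field K) (ι : F →+* K) (σ' : K →+* K) (δ' : SkewDerivation σ'),
          (∀ b : K, σ' b = b ^ p ^ j) ∧ (∀ b : K, δ' b = ι β * (σ' b - b)) ∧
          OrePolynomial.IsExtension ι δ δ' ∧
          ∃ α : K, (f.baseChange ι δ').IsRightRoot α ∧ (g.baseChange ι δ').IsRightRoot α) := by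
  have : Fact p.Prime := ⟨hp⟩
  have hchar : CharP F p := by
    have := Fintype.ofFinite F
    obtain ⟨r, hr⟩ := CharP.exists F
    obtain ⟨n, hrp, hn⟩ := FiniteField.card F r
    rw [← Nat.card_eq_fintype_card, hcard] at hn
    have hdvd : r ∣ p ^ m := hn ▸ dvd_pow_self r n.ne_zero
    rwa [← (Nat.prime_dvd_prime_iff_eq hrp hp).1 (hrp.dvd_of_dvd_pow hdvd)]
  have main : f.resultant g = 0 →
      ∃ (j : ℕ) (β : F), 1 ≤ j ∧ j ≤ m ∧ (∀ a : F, σ a = a ^ p ^ j) ∧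
        (∀ a : F, δ a = β * (σ a - a)) ∧
        ∃ (K : Type v) (_ : Field K) (ι : F →+* K) (σ' : K →+* K) (δ' : SkewDerivation σ'),
          (∀ b : K, σ' b = b ^ p ^ j) ∧ (∀ b : K, δ' b = ι β * (σ' b - b)) ∧
          OrePolynomial.IsExtension ι δ δ' ∧
          ∃ α : K, (f.baseChange ι δ').IsRightRoot α ∧ (g.baseChange ι δ').IsRightRoot α := by
    intro h
    obtain ⟨j, hj1, hjm, hσ⟩ := FiniteField.exists_eq_pow_of_ringHom hcard σ
    obtain ⟨β, hβ⟩ := δ.exists_eq_inner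
    obtain ⟨K, _, _, _, ⟨ι⟩⟩ := FiniteField.exists_ringHom_isAlgClosed.{u, v} F p
    let σ' : K →+* K := iterateFrobenius K p j
    have hσ' : ∀ b, σ' b = b ^ p ^ j := fun b => iterateFrobenius_def p j b
    let δ' : SkewDerivation σ' := SkewDerivation.inner σ' (ι β)
    have hδ' : ∀ b, δ' b = ι β * (σ' b - b) := SkewDerivation.inner_apply σ' (ι β)
    have hext : OrePolynomial.IsExtension ι δ δ' :=
      ⟨fun a => by rw [hσ', hσ, map_pow], fun a => by
        rw [hδ', hβ, map_mul, map_sub, hσ', hσ, map_pow]⟩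
    obtain ⟨d, s, t, hd, hs, ht⟩ :=
      OrePolynomial.exists_common_right_divisor_of_resultant_eq_zero hf hg h
    obtain ⟨α, hα⟩ := OrePolynomial.exists_opEval_eq_zero ι δ' (p ^ j) (pow_pos hp.pos j) (ι β)
      hσ' hδ' d hd
    have hzero : ∀ w : F[X], OrePolynomial.opEval ι (OrePolynomial.varAct δ' α) 0 w = 0 := fun w => by
      simp [OrePolynomial.opEval_apply, Polynomial.sum_def, iterate_map_zero]
    refine ⟨j, β, hj1, hjm, hσ, hβ, K, inferInstance, ι, σ', δ', hσ', hδ', hext, α, ?_, ?_⟩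
    · rw [OrePolynomial.isRightRoot_baseChange_iff, hs,
        OrePolynomial.opEval_mulHom (hext.varAct_mul α), hα, hzero]
    · rw [OrePolynomial.isRightRoot_baseChange_iff, ht,
        OrePolynomial.opEval_mulHom (hext.varAct_mul α), hα, hzero]
  refine ⟨⟨?_, fun h => ?_⟩, main⟩
  · rintro ⟨K, _, ι, σ', δ', hext, α, hα, hα'⟩
    rw [OrePolynomial.isRightRoot_baseChange_iff] at hα hα'
    exact OrePolynomial.resultant_eq_zero_of_opEval (hext.varAct_mul α) hf hα hα'
  · obtain ⟨j, β, -, -, -, -, K, _, ι, σ', δ', -, -, hext, hα⟩ := main h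
    exact ⟨K, inferInstance, ι, σ', δ', hext, hα⟩
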